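/- Let $\ell\ge 7$ be an odd integer, and let $C_3[\ell]$ be the lexicographic product of the $3$-cycle $C_3$ with the empty graph on $\ell$ vertices; that is, the graph on $V(C_3)\times\{0,\dots,\ell-1\}$ in which $(x,h)$ and $(y,h')$ are adjacent if and only if $x$ and $y$ are adjacent in $C_3$. Its parts are the three sets $\{x\}\times\{0,\dots,\ell-1\}$ with $x\in V(C_3)$. Then there are an $\ell$-cycle decomposition of $C_3[\ell]$ (a set of subgraphs of $C_3[\ell]$, each of which is a cycle of length $\ell$, whose edge sets partition the edge set of $C_3[\ell]$) and a colouring of the vertices of $C_3[\ell]$ with the two colours red and blue such that 1. the colouring is equitable for the decomposition: on each cycle of the decomposition, each of the two colours appears on $\lfloor \ell/2\rfloor$ or $\lceil \ell/2\rceil$ vertices; and 2. each of the three parts of $C_3[\ell]$ has exactly $(\ell+1)/2$ red and $(\ell-1)/2$ blue vertices. -/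

import Mathlib

namespace CycleDecomposition

/-- The lexicographic product `G[H]`: its edges are the pairs `(g,h)(g',h')` with `gg'` an edge of
`G`, or with `g = g'` and `hh'` an edge of `H`. -/
def lexProduct {V W : Type*} (G : SimpleGraph V) (H : SimpleGraph W) : SimpleGraph (V × W) where
  Adj p q := G.Adj p.1 q.1 ∨ (p.1 = q.1 ∧ H.Adj p.2 q.2)
  symm := ⟨fun _ _ h => h.elim (fun h => Or.inl h.symm) (fun h => Or.inr ⟨h.1.symm, h.2.symm⟩)⟩
  loopless := ⟨fun _ h => h.elim (fun h => G.irrefl h) (fun h => H.irrefl h.2)⟩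

/-- `G[n]`, the lexicographic product of `G` with the graph on `n` vertices without edges. -/
def blowUp {V : Type*} (G : SimpleGraph V) (n : ℕ) : SimpleGraph (V × Fin n) :=
  lexProduct G (⊥ : SimpleGraph (Fin n))

/-- A `B`-decomposition of `G`: a family of subgraphs of `G`, each isomorphic to `B`, whose edge
sets partition the edge set of `G`. -/
def IsDecomposition {V W : Type*} (G : SimpleGraph V) (B : SimpleGraph W)
    (D : Set G.Subgraph) : Prop :=
  (∀ C ∈ D, Nonempty (C.coe ≃g B)) ∧ ∀ e ∈ G.edgeSet, ∃! C, C ∈ D ∧ e ∈ C.edgeSet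

/-- An `l`-cycle decomposition of `G`. -/
def IsCycleDecomposition {V : Type*} (G : SimpleGraph V) (l : ℕ) (D : Set G.Subgraph) : Prop :=
  IsDecomposition G (SimpleGraph.cycleGraph l) D

/-- A vertex colouring with `c` colours (`c` the size of `S`) is equitable for a family of
`l`-cycles if on each cycle each colour appears on `⌊l / c⌋` or `⌈l / c⌉` vertices. -/
def IsEquitableColouring {V S : Type*} {G : SimpleGraph V} (l : ℕ) (D : Set G.Subgraph)
    (φ : V → S) : Prop :=
  ∀ C ∈ D, ∀ s : S,
    {v ∈ C.verts | φ v = s}.ncard = ⌊(l : ℚ) / (Nat.card S : ℚ)⌋₊ ∨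
    {v ∈ C.verts | φ v = s}.ncard = ⌈(l : ℚ) / (Nat.card S : ℚ)⌉₊

/-- The two colours. -/
inductive Colour where
  | red : Colour
  | blue : Colour

end CycleDecomposition

/-!
Write `l = 2m + 1` and take the vertices of `C₃[l]` to be the pairs `(x, h)` with `x ∈ ℤ/3` and
`h ∈ ℤ/l`, where `h` is called the height. A vertex is red if its height is at most `m`, so each
part has `m + 1` red vertices, and a cycle has `m + 1` red vertices as soon as its heights are all
of `ℤ/l`, or all of `ℤ/l` with one height replaced by another one of the same colour. (Averaging
shows that every cycle must have exactly `m + 1` red vertices.)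

The cycles are lifts of a single cycle in `ℤ/l`. By `exists_cyclic_sequencing` there is a closed
cycle `c` through the nonzero residues whose differences are the nonzero residues, each once. Its
translate `t + c` misses `t` only, and the translates together use every ordered pair of distinct
heights exactly once. Let `π` be a permutation of the heights without fixed points that preserves
colours (`exists_derangement_preserving_le`). The lift of `t + c` starts at height `π t`, goes once
around, and is closed by an edge between two vertices of height `π t`; its heights are then all of
`ℤ/l` with `t` replaced by `π t`, so it has length `l` and the right colours.

The first coordinates are chosen by a sign function `F : ℤ/l → {1, -1}`: an arc whose heights
differ by `d` changes the first coordinate by `F d`. If `F` is even, each edge of `C₃[l]` is an arc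
in exactly one of its two directions, and if `F` sums to `0` in `ℤ/3` then the lifts close up
(`exists_sign`). The `3l` lifts, given by `t` and the first coordinate at the start, then contain
every arc exactly once (`exists_arc_family`).
-/

namespace CycleDecomposition

/-! ### A cyclic sequencing of the nonzero residues -/

/-- A zigzag path `0, 2m, 1, 2m - 1, …` through `{0, …, 2m}`, with `2m` vertices indexed by
`j < 2m`. It omits exactly one value: after the vertex of index `m`, the side whose turn is next
jumps over a vertex, so that the gap `m` does not occur. -/
def zigzag (m j : ℕ) : ℕ :=
  if j % 2 = 0 then j / 2 + (if m < j ∧ j % 2 ≠ m % 2 then 1 else 0)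
  else 2 * m - j / 2 - (if m < j ∧ j % 2 ≠ m % 2 then 1 else 0)

/-- The value in `{0, …, 2m}` that `zigzag m` omits. -/
def zigzagSkip (m : ℕ) : ℕ := if m % 2 = 0 then 3 * m / 2 else (m + 1) / 2

/-- The residue in `{1, …, 2m}` modulo `2m + 1` of the `j`-th step of `zigzag m`, the step of index
`2m - 1` being the one that closes the path to a cycle. -/
def zigzagStep (m j : ℕ) : ℕ :=
  if j + 1 = 2 * m then (if m % 2 = 0 then m + 1 else m)
  else if j < m then (if j % 2 = 0 then 2 * m - j else j + 1)
  else (if j % 2 = 0 then 2 * m - 1 - j else j + 2)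

theorem zigzag_le {m j : ℕ} (hj : j < 2 * m) : zigzag m j ≤ 2 * m := by
  unfold zigzag; split_ifs <;> omega

theorem zigzag_injOn {m i j : ℕ} (hi : i < 2 * m) (hj : j < 2 * m)
    (h : zigzag m i = zigzag m j) : i = j := by
  unfold zigzag at h; split_ifs at h <;> omega

theorem zigzag_ne_skip {m j : ℕ} (hj : j < 2 * m) : zigzag m j ≠ zigzagSkip m := by
  unfold zigzag zigzagSkip; split_ifs <;> omega

theorem zigzagStep_lt {m j : ℕ} (hm : 2 ≤ m) (hj : j < 2 * m) : zigzagStep m j < 2 * m + 1 := by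
  unfold zigzagStep; split_ifs <;> omega

/-- The steps before the jump are the even residues, those after it are odd, and the closing step is
the one odd residue left over. -/
theorem zigzagStep_injOn {m i j : ℕ} (hi : i < 2 * m) (hj : j < 2 * m)
    (h : zigzagStep m i = zigzagStep m j) : i = j := by
  unfold zigzagStep at h; split_ifs at h <;> omega

theorem zigzag_add_step {m j : ℕ} (hj : j < 2 * m) :
    zigzag m j + zigzagStep m j =
      zigzag m ((j + 1) % (2 * m)) + (if j % 2 = 0 then 0 else 2 * m + 1) := by
  by_cases hl : j + 1 = 2 * m
  · rw [hl, Nat.mod_self]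
    unfold zigzag zigzagStep; split_ifs <;> omega
  · rw [Nat.mod_eq_of_lt (by omega)]
    unfold zigzag zigzagStep; split_ifs <;> omega

/-- The nonzero residues modulo `2m + 1` can be arranged in a closed cycle whose `2m` consecutive
differences are pairwise distinct. The cycle is encoded as a sequence of period `2m`. -/
theorem exists_cyclic_sequencing {m : ℕ} (hm : 2 ≤ m) :
    ∃ c : ℕ → ZMod (2 * m + 1), (∀ n, c (n + 2 * m) = c n) ∧ (∀ n, c n ≠ 0) ∧
      (∀ i j, c i = c j → i ≡ j [MOD 2 * m]) ∧
      ∀ i j, c (i + 1) - c i = c (j + 1) - c j → i ≡ j [MOD 2 * m] := by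
  have hlt (n : ℕ) : n % (2 * m) < 2 * m := Nat.mod_lt _ (by omega)
  have hs : zigzagSkip m < 2 * m + 1 := by unfold zigzagSkip; split_ifs <;> omega
  have cast_inj {a b : ℕ} (ha : a < 2 * m + 1) (hb : b < 2 * m + 1)
      (h : (a : ZMod (2 * m + 1)) = b) : a = b := by
    rw [ZMod.natCast_eq_natCast_iff] at h
    exact h.eq_of_lt_of_lt ha hb
  have hle (n : ℕ) := Nat.lt_succ_of_le (zigzag_le (hlt n))
  have hd (n : ℕ) : ((zigzag m ((n + 1) % (2 * m)) : ℕ) : ZMod (2 * m + 1)) -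
      (zigzag m (n % (2 * m)) : ℕ) = (zigzagStep m (n % (2 * m)) : ℕ) := by
    have h := congrArg (Nat.cast : ℕ → ZMod (2 * m + 1)) (zigzag_add_step (hlt n))
    have h0 : (((if n % (2 * m) % 2 = 0 then 0 else 2 * m + 1 : ℕ)) : ZMod (2 * m + 1)) = 0 := by
      split_ifs
      · simp
      · exact ZMod.natCast_self _
    rw [Nat.mod_add_mod, Nat.cast_add, Nat.cast_add, h0] at h
    linear_combination -h
  refine ⟨fun n => (zigzag m (n % (2 * m)) : ℕ) - (zigzagSkip m : ℕ), fun n => ?_, fun n h => ?_,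
    fun i j h => ?_, fun i j h => ?_⟩
  · simp
  · exact zigzag_ne_skip (hlt n) (cast_inj (hle n) hs (sub_eq_zero.mp h))
  · exact zigzag_injOn (hlt i) (hlt j) (cast_inj (hle i) (hle j) (sub_left_inj.mp h))
  · rw [sub_sub_sub_cancel_right, sub_sub_sub_cancel_right, hd, hd] at h
    exact zigzagStep_injOn (hlt i) (hlt j)
      (cast_inj (zigzagStep_lt hm (hlt i)) (zigzagStep_lt hm (hlt j)) h)

/-! ### Signs of the steps -/

/-- The even function is `-1` on a symmetric set `T` of nonzero residues and `1` elsewhere. In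
`ZMod 3` its sum is `l - 2|T| = l + |T|`, so `T` is taken of size `0`, `2` or `4` according to the
residue of `l` modulo `3`. -/
theorem exists_sign {l : ℕ} [NeZero l] (hl : 5 ≤ l) :
    ∃ F : ZMod l → ZMod 3, (∀ d, F (-d) = F d) ∧ (∀ d, F d = 1 ∨ F d = -1) ∧ F 0 = 1 ∧
      ∑ d, F d = 0 := by
  have key (T : Finset (ZMod l)) (hneg : ∀ d, -d ∈ T ↔ d ∈ T) (h0 : (0 : ZMod l) ∉ T)
      (hc : (l : ZMod 3) + T.card = 0) :
      ∃ F : ZMod l → ZMod 3, (∀ d, F (-d) = F d) ∧ (∀ d, F d = 1 ∨ F d = -1) ∧ F 0 = 1 ∧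
        ∑ d, F d = 0 := by
    -- In `ZMod 3`, the value `1 + 1` is `-1`.
    refine ⟨fun d => 1 + if d ∈ T then 1 else 0, fun d => by simp only [hneg], fun d => ?_,
      by simp [h0], ?_⟩
    · by_cases h : d ∈ T
      · simp only [h, if_true]; decide
      · simp [h]
    · rw [Finset.sum_add_distrib, Finset.sum_ite_mem, Finset.univ_inter]
      simpa [ZMod.card] using hc
  have ne (a : ℕ) (h : 0 < a) (h' : a < l) : (a : ZMod l) ≠ 0 := by
    rw [Ne, ZMod.natCast_eq_zero_iff]
    exact Nat.not_dvd_of_pos_of_lt h h'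
  have n1 := ne 1 (by omega) (by omega)
  have n2 := ne 2 (by omega) (by omega)
  have n3 := ne 3 (by omega) (by omega)
  have n4 := ne 4 (by omega) (by omega)
  push_cast at n1 n2 n3 n4
  have hl3 : (l : ZMod 3) = (l % 3 : ℕ) := by simp
  have : l % 3 < 3 := Nat.mod_lt _ (by omega)
  interval_cases h : l % 3
  · exact key ∅ (by simp) (by simp) (by simpa using hl3)
  · refine key {1, -1} (fun d => ?_) ?_ ?_
    · simp [neg_eq_iff_eq_neg, or_comm]
    · simpa using ⟨fun h => n1 h.symm, n1⟩
    · rw [Finset.card_pair (fun h => n2 (by linear_combination h)), hl3]; decide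
  · refine key {1, -1, 2, -2} (fun d => ?_) ?_ ?_
    · simp only [Finset.mem_insert, Finset.mem_singleton, neg_eq_iff_eq_neg, neg_neg]; tauto
    · simp only [Finset.mem_insert, Finset.mem_singleton, not_or]
      exact ⟨fun h => n1 h.symm, fun h => n1 (by linear_combination h), fun h => n2 h.symm,
        fun h => n2 (by linear_combination h)⟩
    · rw [Finset.card_insert_of_notMem, Finset.card_insert_of_notMem, Finset.card_pair, hl3]
      · decide
      · exact fun h => n4 (by linear_combination h)
      · simp only [Finset.mem_insert, Finset.mem_singleton, not_or]
        exact ⟨fun h => n3 (by linear_combination -h), fun h => n1 (by linear_combination h)⟩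
      · simp only [Finset.mem_insert, Finset.mem_singleton, not_or]
        exact ⟨fun h => n2 (by linear_combination h), fun h => n1 (by linear_combination -h),
          fun h => n3 (by linear_combination h)⟩

/-- A cyclic sequencing `c` of the nonzero residues with an even sign function `F`, and the partial
sums `X` of the signs of the steps of `c`. The last clause says that a step of sign `F 0` closes
one period of `X`. -/
theorem exists_sequencing_with_labels {m : ℕ} (hm : 2 ≤ m) :
    ∃ (c : ℕ → ZMod (2 * m + 1)) (F : ZMod (2 * m + 1) → ZMod 3) (X : ℕ → ZMod 3),
      (∀ n, c (n + 2 * m) = c n) ∧ (∀ d, d ≠ 0 → ∃ n, c n = d) ∧ (∀ n, c (n + 1) - c n ≠ 0) ∧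
      (∀ i j, c i = c j → i ≡ j [MOD 2 * m]) ∧
      (∀ n, c n ≠ 0) ∧
      (∀ i j, c (i + 1) - c i = c (j + 1) - c j → i ≡ j [MOD 2 * m]) ∧
      (∀ d, F (-d) = F d) ∧ (∀ d, F d = 1 ∨ F d = -1) ∧
      (∀ n, X (n + 1) - X n = F (c (n + 1) - c n)) ∧
      ∀ n, X n - X (n + 2 * m) = F 0 := by
  obtain ⟨c, hper, h0, hinj, hdiff⟩ := exists_cyclic_sequencing hm
  obtain ⟨F, hneg, hF, hF0, hsum⟩ := exists_sign (l := 2 * m + 1) (by omega)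
  -- Both `c` and its difference sequence run through every nonzero residue once per period.
  have image_eq (g : ℕ → ZMod (2 * m + 1)) (hg : ∀ n, g n ≠ 0)
      (hgi : ∀ i j, g i = g j → i ≡ j [MOD 2 * m]) :
      Set.InjOn g (Finset.range (2 * m)) ∧
        (Finset.range (2 * m)).image g = Finset.univ.erase 0 := by
    have hi : Set.InjOn g (Finset.range (2 * m)) := fun i hi j hj h =>
      (hgi i j h).eq_of_lt_of_lt (by simpa using hi) (by simpa using hj)
    refine ⟨hi, Finset.eq_of_subset_of_card_le (fun d hd => ?_) ?_⟩
    · obtain ⟨n, -, rfl⟩ := Finset.mem_image.mp hd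
      simpa using hg n
    · rw [Finset.card_image_of_injOn hi, Finset.card_erase_of_mem (Finset.mem_univ _),
        Finset.card_univ, ZMod.card, Finset.card_range, Nat.add_sub_cancel]
  have hstep (n : ℕ) : c (n + 1) - c n ≠ 0 := fun h => by
    have h1 : 1 ≡ 0 [MOD 2 * m] := Nat.ModEq.add_left_cancel' n (hinj (n + 1) n (sub_eq_zero.mp h))
    exact one_ne_zero (h1.eq_of_lt_of_lt (by omega) (by omega))
  refine ⟨c, F, fun n => ∑ j ∈ Finset.range n, F (c (j + 1) - c j), hper, fun d hd => ?_, hstep,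
    hinj, h0, hdiff, hneg, hF, fun n => ?_, fun n => ?_⟩
  · have : d ∈ (Finset.range (2 * m)).image c := by
      rw [(image_eq c h0 hinj).2]; simpa using hd
    obtain ⟨n, -, h⟩ := Finset.mem_image.mp this
    exact ⟨n, h⟩
  · simp [Finset.sum_range_succ]
  -- The steps run once through all nonzero residues, so their signs sum to `-F 0`.
  · induction n with
    | zero =>
      have h := image_eq (fun n => c (n + 1) - c n) hstep hdiff
      have h2 := Finset.sum_image (f := F) h.1
      rw [h.2] at h2
      rw [← Finset.add_sum_erase _ F (Finset.mem_univ 0)] at hsum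
      simp only [Finset.sum_range_zero, Nat.zero_add, ← h2]
      linear_combination -hsum
    | succ n ih =>
      have h1 := hper n
      have h2 := hper (n + 1)
      rw [add_right_comm] at h2
      simp only [add_right_comm n 1 (2 * m), Finset.sum_range_succ, h1, h2]
      linear_combination ih

/-! ### Colours -/

/-- The shift `t ↦ t + 1` cycles through all residues; composing it with the transposition of `0` and
`m + 1` splits it into a cycle on `{0, …, m}` and a cycle on `{m + 1, …, 2m}`. -/
theorem exists_derangement_preserving_le {m : ℕ} (hm : 2 ≤ m) :
    ∃ π : Equiv.Perm (ZMod (2 * m + 1)), (∀ t, π t ≠ t) ∧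
      ∀ t : ZMod (2 * m + 1), (π t).val ≤ m ↔ t.val ≤ m := by
  refine ⟨(Equiv.addRight 1).trans (Equiv.swap 0 ((m + 1 : ℕ) : ZMod (2 * m + 1))), ?_⟩
  have hv : ((m + 1 : ℕ) : ZMod (2 * m + 1)).val = m + 1 := ZMod.val_natCast_of_lt (by omega)
  have h1 : (1 : ZMod (2 * m + 1)).val = 1 := by
    simpa using ZMod.val_natCast_of_lt (n := 2 * m + 1) (a := 1) (by omega)
  have main (t : ZMod (2 * m + 1)) :
      (Equiv.swap 0 ((m + 1 : ℕ) : ZMod (2 * m + 1)) (t + 1)).val ≠ t.val ∧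
      ((Equiv.swap 0 ((m + 1 : ℕ) : ZMod (2 * m + 1)) (t + 1)).val ≤ m ↔ t.val ≤ m) := by
    have ht := t.val_lt
    have hadd : t.val = 2 * m ∧ (t + 1).val = 0 ∨ t.val < 2 * m ∧ (t + 1).val = t.val + 1 := by
      rw [ZMod.val_add, h1]
      rcases (Nat.le_of_lt_succ ht).eq_or_lt with h | h
      · exact Or.inl ⟨h, by rw [h, Nat.mod_self]⟩
      · exact Or.inr ⟨h, Nat.mod_eq_of_lt (by omega)⟩
    rw [Equiv.swap_apply_def]
    simp only [← (ZMod.val_injective (2 * m + 1)).eq_iff, hv, ZMod.val_zero]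
    split_ifs <;> (try simp only [hv, ZMod.val_zero]) <;> omega
  exact ⟨fun t h => (main t).1 (congrArg ZMod.val h), fun t => (main t).2⟩

theorem natCard_colour : Nat.card Colour = 2 := by
  let e : Colour ≃ Bool :=
    { toFun := fun c => match c with | .red => true | .blue => false
      invFun := fun b => if b then .red else .blue
      left_inv := fun c => by cases c <;> rfl
      right_inv := fun b => by cases b <;> rfl }
  rw [Nat.card_congr e]; simp

/-- The colour of a vertex at height `h`: red if `h ≤ m` and blue otherwise. -/
def thresholdColour (m h : ℕ) : Colour := if h ≤ m then .red else .blue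

theorem thresholdColour_eq_iff {m h k : ℕ} :
    thresholdColour m h = thresholdColour m k ↔ (h ≤ m ↔ k ≤ m) := by
  unfold thresholdColour; split_ifs <;> simp [*]

theorem ncard_thresholdColour_red (m : ℕ) :
    {h : Fin (2 * m + 1) | thresholdColour m h = .red}.ncard = m + 1 := by
  have : {h : Fin (2 * m + 1) | thresholdColour m h = .red} =
      (Finset.Iic (⟨m, by omega⟩ : Fin (2 * m + 1)) : Finset (Fin (2 * m + 1))) := by
    ext h; simp [thresholdColour, Fin.le_def]
  rw [this, Set.ncard_coe_finset, Fin.card_Iic]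

theorem ncard_thresholdColour_blue (m : ℕ) :
    {h : Fin (2 * m + 1) | thresholdColour m h = .blue}.ncard = m := by
  have : {h : Fin (2 * m + 1) | thresholdColour m h = .blue} =
      (Finset.Ioi (⟨m, by omega⟩ : Fin (2 * m + 1)) : Finset (Fin (2 * m + 1))) := by
    ext h; simp [thresholdColour, Fin.lt_def]
  rw [this, Set.ncard_coe_finset, Fin.card_Ioi]; simp; omega

/-! ### Decompositions into cycles -/

/-- Orient every edge of `G` in exactly one way, as prescribed by `Arc`. Closed directed walks without
repeated vertices that use every arc exactly once form a cycle decomposition of `G`. -/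
theorem exists_isCycleDecomposition_of_arcs {V ι : Type*} {G : SimpleGraph V} {l : ℕ} [NeZero l]
    (hl : 2 ≤ l) (Arc : V → V → Prop) (hadj : ∀ u v, Arc u v → G.Adj u v)
    (hor : ∀ u v, G.Adj u v → Arc u v ∨ Arc v u) (hasymm : ∀ u v, Arc u v → ¬ Arc v u)
    (γ : ι → Fin l → V) (hγ : ∀ k, Function.Injective (γ k))
    (hstep : ∀ k i, Arc (γ k i) (γ k (i + 1)))
    (huniq : ∀ u v, Arc u v → ∃! k, ∃ i, γ k i = u ∧ γ k (i + 1) = v) :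
    ∃ D : Set G.Subgraph, IsCycleDecomposition G l D ∧
      ∀ C ∈ D, ∃ k, C.verts = Set.range (γ k) := by
  obtain ⟨n, rfl⟩ := Nat.exists_eq_add_of_le' hl
  let f (k : ι) : (SimpleGraph.cycleGraph (n + 2)).Copy G :=
    ⟨⟨γ k, fun {i j} h => by
      rw [SimpleGraph.cycleGraph_adj] at h
      rcases h with h | h
      · rw [sub_eq_iff_eq_add'.mp h]
        exact (hadj _ _ (hstep k j)).symm
      · rw [sub_eq_iff_eq_add'.mp h]
        exact hadj _ _ (hstep k i)⟩, hγ k⟩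
  have mem_iff (k : ι) {u v : V} (h : Arc u v) :
      s(u, v) ∈ (f k).toSubgraph.edgeSet ↔ ∃ i, γ k i = u ∧ γ k (i + 1) = v := by
    rw [SimpleGraph.Subgraph.mem_edgeSet, SimpleGraph.Subgraph.map_adj]
    constructor
    · rintro ⟨i, j, hij, rfl, rfl⟩
      have hij' : i - j = 1 ∨ j - i = 1 := SimpleGraph.cycleGraph_adj.mp hij
      rcases hij' with h' | h'
      · obtain rfl : i = j + 1 := sub_eq_iff_eq_add'.mp h'
        exact absurd (hstep k j) (hasymm _ _ h)
      · obtain rfl : j = i + 1 := sub_eq_iff_eq_add'.mp h'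
        exact ⟨i, rfl, rfl⟩
    · rintro ⟨i, rfl, rfl⟩
      exact ⟨i, i + 1, SimpleGraph.cycleGraph_adj.mpr (Or.inr (by simp)), rfl, rfl⟩
  have hedge {u v : V} (h : Arc u v) :
      ∃! C, C ∈ Set.range (fun k => (f k).toSubgraph) ∧ s(u, v) ∈ C.edgeSet := by
    obtain ⟨k, hk, hk'⟩ := huniq u v h
    refine ⟨(f k).toSubgraph, ⟨⟨k, rfl⟩, (mem_iff k h).mpr hk⟩, ?_⟩
    rintro _ ⟨⟨k', rfl⟩, h'⟩
    rw [hk' k' ((mem_iff k' h).mp h')]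
  refine ⟨Set.range fun k => (f k).toSubgraph, ⟨?_, fun e => ?_⟩, ?_⟩
  · rintro _ ⟨k, rfl⟩
    exact ⟨(f k).isoToSubgraph.symm⟩
  · induction e using Sym2.ind with
    | _ u v =>
      intro h
      rcases hor u v h with h | h
      · exact hedge h
      · rw [Sym2.eq_swap]
        exact hedge h
  · rintro _ ⟨k, rfl⟩
    refine ⟨k, ?_⟩
    ext v
    simp [f]

theorem blowUp_cycleGraph_three_adj {l : ℕ} {u v : Fin 3 × Fin l} :
    (blowUp (SimpleGraph.cycleGraph 3) l).Adj u v ↔ u.1 ≠ v.1 := by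
  have h (x y : Fin 3) : (SimpleGraph.cycleGraph 3).Adj x y ↔ x ≠ y := by
    simp [SimpleGraph.cycleGraph_three_eq_top]
  simp [blowUp, lexProduct, h]

/-- The directed cycles of the decomposition, indexed by `(a, t)`. The
bijection `ψ` lists the heights along a cycle, except that it has `t` in one place where the cycle
has another height on the same side of `m`. -/
theorem exists_arc_family {m : ℕ} (hm : 2 ≤ m) :
    ∃ (Arc : ZMod 3 × ZMod (2 * m + 1) → ZMod 3 × ZMod (2 * m + 1) → Prop)
      (γ : ZMod 3 × ZMod (2 * m + 1) → Fin (2 * m + 1) → ZMod 3 × ZMod (2 * m + 1)),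
      (∀ u v, Arc u v → u.1 ≠ v.1) ∧ (∀ u v, u.1 ≠ v.1 → Arc u v ∨ Arc v u) ∧
      (∀ u v, Arc u v → ¬ Arc v u) ∧ (∀ k, Function.Injective (γ k)) ∧
      (∀ k i, Arc (γ k i) (γ k (i + 1))) ∧
      (∀ u v, Arc u v → ∃! k, ∃ i, γ k i = u ∧ γ k (i + 1) = v) ∧
      ∀ k, ∃ ψ : Fin (2 * m + 1) → ZMod (2 * m + 1), Function.Bijective ψ ∧
        ∀ i, (γ k i).2.val ≤ m ↔ (ψ i).val ≤ m := by
  obtain ⟨c, F, X, hper, hsurj, hne, hinj, h0, hdiff, hneg, hF, hX, hX'⟩ :=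
    exists_sequencing_with_labels hm
  obtain ⟨π, hπ, hcol⟩ := exists_derangement_preserving_le hm
  choose p hp using fun t => hsurj (π t - t) (sub_ne_zero.mpr (hπ t))
  have mod_inj (q : ℕ) {i j : ℕ} (hi : i < 2 * m) (hj : j < 2 * m)
      (h : q + i ≡ q + j [MOD 2 * m]) : i = j :=
    (Nat.ModEq.add_left_cancel' q h).eq_of_lt_of_lt hi hj
  have hFne (d) : F d ≠ 0 := by
    rcases hF d with h | h <;> rw [h] <;> decide
  -- The cycle `(a, t)` follows the translate by `t` of the sequencing once around, starting and
  -- ending at height `π t`; its closing edge is the one between two vertices of equal height.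
  let γ (k : ZMod 3 × ZMod (2 * m + 1)) (i : Fin (2 * m + 1)) : ZMod 3 × ZMod (2 * m + 1) :=
    (k.1 + X (p k.2 + i), k.2 + c (p k.2 + i))
  -- The difference of heights along the arc of index `i`.
  let δ (k : ZMod 3 × ZMod (2 * m + 1)) (i : Fin (2 * m + 1)) := (γ k (i + 1)).2 - (γ k i).2
  have lt_of_ne (i : Fin (2 * m + 1)) (h : i ≠ Fin.last _) : i.val < 2 * m := Fin.val_lt_last h
  have last_snd (k) : (γ k (Fin.last _)).2 = π k.2 := by
    simp only [γ, Fin.val_last, hper, hp, add_sub_cancel]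
  have zero_snd (k) : (γ k 0).2 = π k.2 := by
    simp only [γ, Fin.val_zero, add_zero, hp, add_sub_cancel]
  have δ_last (k) : δ k (Fin.last _) = 0 := by
    simp only [δ, Fin.last_add_one, last_snd, zero_snd, sub_self]
  have δ_lt (k) (i : Fin (2 * m + 1)) (h : i ≠ Fin.last _) :
      δ k i = c (p k.2 + i + 1) - c (p k.2 + i) := by
    simp only [δ, γ, Fin.val_add_one, h, if_false, add_sub_add_left_eq_sub, add_assoc]
  have step (k i) : (γ k (i + 1)).1 - (γ k i).1 = F (δ k i) := by
    by_cases h : i = Fin.last _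
    · subst h
      rw [δ_last, ← hX' (p k.2)]
      simp only [γ, Fin.last_add_one, Fin.val_zero, Fin.val_last, add_zero, add_sub_add_left_eq_sub]
    · rw [δ_lt k i h, ← hX]
      simp only [γ, Fin.val_add_one, h, if_false, add_sub_add_left_eq_sub, add_assoc]
  have γ_inj (k) : Function.Injective (γ k) := by
    have last (j : Fin (2 * m + 1)) (hj : j ≠ Fin.last _) : γ k (Fin.last _) ≠ γ k j := fun h => by
      have h1 := congrArg Prod.fst h
      have h2 := congrArg Prod.snd h
      rw [last_snd, ← zero_snd] at h2
      have hj0 := mod_inj _ (by simp; omega) (lt_of_ne j hj) (hinj _ _ (add_left_cancel h2))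
      have h3 := add_left_cancel h1
      rw [← hj0, Fin.val_zero, Fin.val_last, add_zero] at h3
      -- If the closing edge were a loop, then `X` would have period `2m`, and `F 0` would vanish.
      exact hFne 0 (by rw [← hX' (p k.2), h3, sub_self])
    intro i j h
    by_cases hi : i = Fin.last _ <;> by_cases hj : j = Fin.last _
    · rw [hi, hj]
    · exact absurd (hi ▸ h) (last j hj)
    · exact absurd (hj ▸ h.symm) (last i hi)
    · exact Fin.ext (mod_inj _ (lt_of_ne i hi) (lt_of_ne j hj)
        (hinj _ _ (add_left_cancel (congrArg Prod.snd h))))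
  -- An arc is determined by its tail and its difference of heights, so it suffices that `Φ` is
  -- bijective; domain and codomain have the same size.
  let Φ (x : (ZMod 3 × ZMod (2 * m + 1)) × Fin (2 * m + 1)) := (γ x.1 x.2, δ x.1 x.2)
  have Φ_bij : Function.Bijective Φ := by
    refine (Fintype.bijective_iff_injective_and_card _).mpr ⟨?_, by simp [ZMod.card]⟩
    rintro ⟨⟨a, t⟩, i⟩ ⟨⟨b, s⟩, j⟩ h
    obtain ⟨hγ, hδ⟩ := Prod.mk.inj h
    obtain ⟨h1, h2⟩ := Prod.mk.inj hγ
    simp only at h1 h2 hδ hγ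
    have key : t = s ∧ i = j := by
      by_cases hi : i = Fin.last _ <;> by_cases hj : j = Fin.last _
      · subst hi hj
        have := congrArg Prod.snd hγ
        rw [last_snd, last_snd] at this
        exact ⟨π.injective this, rfl⟩
      -- Only closing arcs have equal heights at both ends.
      · rw [hi, δ_last, δ_lt _ j hj] at hδ
        exact absurd hδ.symm (hne _)
      · rw [hj, δ_last, δ_lt _ i hi] at hδ
        exact absurd hδ (hne _)
      · rw [δ_lt _ i hi, δ_lt _ j hj] at hδ
        have hn := hdiff _ _ hδ
        have hc : c (p t + i) = c (p s + j) := by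
          have hmod (n) : c n = c (n % (2 * m)) :=
            ((show Function.Periodic c (2 * m) from hper).map_mod_nat n).symm
          rw [hmod, hn, ← hmod]
        rw [hc] at h2
        obtain rfl := add_right_cancel h2
        exact ⟨rfl, Fin.ext (mod_inj _ (lt_of_ne i hi) (lt_of_ne j hj) hn)⟩
    obtain ⟨rfl, rfl⟩ := key
    rw [add_right_cancel h1]
  have sign (x : ZMod 3) (hx : x ≠ 0) (y : ZMod 3) (hy : y = 1 ∨ y = -1) : x = y ∨ -x = y := by
    revert x y; decide
  have nsign (x : ZMod 3) (hx : x ≠ 0) : -x ≠ x := by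
    revert x; decide
  refine ⟨fun u v => v.1 - u.1 = F (v.2 - u.2), γ, fun u v h he => ?_, fun u v h => ?_,
    fun u v h h' => ?_, γ_inj, step, fun u v h => ?_, fun k => ?_⟩
  · exact hFne _ (h.symm.trans (sub_eq_zero.mpr he.symm))
  · change v.1 - u.1 = F (v.2 - u.2) ∨ u.1 - v.1 = F (u.2 - v.2)
    rw [← neg_sub v.2 u.2, hneg, ← neg_sub v.1 u.1]
    exact sign _ (sub_ne_zero.mpr h.symm) _ (hF _)
  · change v.1 - u.1 = F (v.2 - u.2) at h
    change u.1 - v.1 = F (u.2 - v.2) at h'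
    rw [← neg_sub v.2 u.2, hneg, ← h, ← neg_sub v.1 u.1] at h'
    exact nsign _ (h ▸ hFne _) h'
  · have iff (k i) : (γ k i = u ∧ γ k (i + 1) = v) ↔ Φ (k, i) = (u, v.2 - u.2) := by
      constructor
      · rintro ⟨rfl, rfl⟩; rfl
      · intro h'
        obtain ⟨h1, h2⟩ := Prod.mk.inj h'
        simp only at h1 h2
        refine ⟨h1, Prod.ext ?_ ?_⟩
        · have := step k i
          rw [h2, ← h, h1] at this
          exact sub_left_injective this
        · simp only [δ, h1] at h2
          exact sub_left_injective h2
    simp only [iff]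
    obtain ⟨⟨k, i⟩, hk⟩ := Φ_bij.2 (u, v.2 - u.2)
    refine ⟨k, ⟨i, hk⟩, ?_⟩
    rintro k' ⟨i', hk'⟩
    exact congrArg Prod.fst (Φ_bij.1 (hk'.trans hk.symm))
  -- `ψ` puts `t` back in the place of the second occurrence of `π t`.
  · refine ⟨fun i => if i = Fin.last _ then k.2 else (γ k i).2, ?_, fun i => ?_⟩
    · refine (Fintype.bijective_iff_injective_and_card _).mpr ⟨fun i j h => ?_, by simp [ZMod.card]⟩
      have hne' (i) : (γ k i).2 ≠ k.2 := fun h => h0 _ (left_eq_add.mp h.symm)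
      simp only at h
      split_ifs at h with hi hj hj
      · rw [hi, hj]
      · exact absurd h.symm (hne' _)
      · exact absurd h (hne' _)
      · exact Fin.ext (mod_inj _ (lt_of_ne i hi) (lt_of_ne j hj) (hinj _ _ (add_left_cancel h)))
    · by_cases hi : i = Fin.last _
      · simp only [hi, if_true, last_snd, hcol]
      · simp only [hi, if_false]

end CycleDecomposition

open CycleDecomposition

theorem mainTheorem5 (l : ℕ) (hodd : Odd l) (hl : 7 ≤ l) :
    ∃ (D : Set (CycleDecomposition.blowUp (SimpleGraph.cycleGraph 3) l).Subgraph)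
      (φ : Fin 3 × Fin l → CycleDecomposition.Colour),
      CycleDecomposition.IsCycleDecomposition
        (CycleDecomposition.blowUp (SimpleGraph.cycleGraph 3) l) l D ∧
      CycleDecomposition.IsEquitableColouring l D φ ∧
      ∀ i : Fin 3,
        {v : Fin 3 × Fin l | v.1 = i ∧ φ v = CycleDecomposition.Colour.red}.ncard = (l + 1) / 2 ∧
        {v : Fin 3 × Fin l | v.1 = i ∧ φ v = CycleDecomposition.Colour.blue}.ncard =
          (l - 1) / 2 := by
  obtain ⟨m, rfl⟩ := hodd
  obtain ⟨Arc, γ, hadj, hor, hasymm, hγ, hstep, huniq, hψ⟩ := exists_arc_family (m := m) (by omega)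
  obtain ⟨D, hD, hverts⟩ := exists_isCycleDecomposition_of_arcs
    (G := CycleDecomposition.blowUp (SimpleGraph.cycleGraph 3) (2 * m + 1)) (by omega) Arc
    (fun u v h => blowUp_cycleGraph_three_adj.mpr (hadj u v h))
    (fun u v h => hor u v (blowUp_cycleGraph_three_adj.mp h)) hasymm γ hγ hstep huniq
  -- Both in a part and on a cycle, the colours are distributed as on the set of all heights.
  have part (i : Fin 3) (s : Colour) :
      {v : Fin 3 × Fin (2 * m + 1) | v.1 = i ∧ thresholdColour m v.2 = s}.ncard =
        {h : Fin (2 * m + 1) | thresholdColour m h = s}.ncard := by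
    have h1 : {v : Fin 3 × Fin (2 * m + 1) | v.1 = i ∧ thresholdColour m v.2 = s} =
        Prod.mk i '' {h : Fin (2 * m + 1) | thresholdColour m h = s} := by
      ext ⟨x, h⟩
      simp [eq_comm, and_comm]
    rw [h1, Set.ncard_image_of_injective _ (Prod.mk_right_injective i)]
  have cycle (C) (hC : C ∈ D) (s : Colour) :
      {v ∈ C.verts | thresholdColour m v.2 = s}.ncard =
        {h : Fin (2 * m + 1) | thresholdColour m h = s}.ncard := by
    obtain ⟨k, hk⟩ := hverts C hC
    obtain ⟨ψ, hbij, hle⟩ := hψ k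
    have hcol (i) : thresholdColour m (γ k i).2.val = thresholdColour m (ψ i).val :=
      thresholdColour_eq_iff.mpr (hle i)
    have h1 : {v ∈ C.verts | thresholdColour m v.2 = s} =
        γ k '' {i | thresholdColour m (ψ i).val = s} := by
      ext v
      rw [hk]
      constructor
      · rintro ⟨⟨i, rfl⟩, h⟩
        exact ⟨i, (hcol i).symm.trans h, rfl⟩
      · rintro ⟨i, h, rfl⟩
        exact ⟨⟨i, rfl⟩, (hcol i).trans h⟩
    refine (congrArg Set.ncard h1).trans ((Set.ncard_image_of_injective _ (hγ k)).trans ?_)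
    exact Set.ncard_preimage_of_injective_subset_range (s := {h : Fin (2 * m + 1) |
      thresholdColour m h = s}) hbij.1 (fun h _ => hbij.2 h)
  refine ⟨D, fun v => thresholdColour m v.2, hD, fun C hC s => ?_, fun i => ?_⟩
  · rw [cycle C hC s, natCard_colour]
    cases s
    · right
      rw [ncard_thresholdColour_red, eq_comm, Nat.ceil_eq_iff (by omega)]
      push_cast
      constructor <;> linarith
    · left
      rw [ncard_thresholdColour_blue, eq_comm, Nat.floor_eq_iff (by positivity)]
      push_cast
      constructor <;> linarith
  · rw [part, part, ncard_thresholdColour_red, ncard_thresholdColour_blue]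
    omega
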